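/- Graphs are finite, simple and undirected. For a graph $G=(V,E)$ let $d$ be the shortest-path distance ($+\infty$ between nodes not joined by a path), and let $Net(u,v)=|\{w\in V: d(w,u)<d(w,v)\}|$. Write $u\succ v$ if $Net(u,v)>Net(v,u)$, $u\sim v$ if $Net(u,v)=Net(v,u)$, and $u\succeq v$ if $u\succ v$ or $u\sim v$. A node $u$ is a Condorcet winner if $u\succ v$ for every node $v\neq u$. A centrality measure $F$ assigns a real number $F_v(G)$ to every node $v$ of every graph $G$, and $\mathrm{Top}_F(G)=\{v\in V: F_v(G)\ge F_w(G)\text{ for every }w\in V\}$. $F$ is Condorcet consistent on trees if $\mathrm{Top}_F(G)=\{u\}$ for every tree $G$ with a Condorcet winner $u$. $F$ satisfies Condorcet Comparison in Trees (CCT) if for every tree $G=(V,E)$ and every edge $\{u,v\}\in E$: $u\succeq v \Leftrightarrow F_u(G)\ge F_v(G)$. The hitting time $H(u,v)$ is the expected number of steps before the simple random walk on $G$ (which moves at each step to a uniformly random neighbour of the current node) started at $u$ visits $v$; in particular $H(v,v)=0$. Random-Walk Closeness of a node $v$ in a connected graph $G$ is $$RWC_v(G)=\Big(\sum_{u\in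 V\setminus\{v\}}H(u,v)\Big)^{-1},$$ with the convention that it is $0$ for the graph with a single node. Theorem. Random-Walk Closeness is Condorcet consistent on trees, and it satisfies CCT. Moreover, let $G=(V,E)$ be a tree with $n$ nodes. Then $H(u,v)$ is finite for all $u,v\in V$, and for every edge $\{u,v\}\in E$, with $S_u$ and $S_v$ the connected components of $G-\{u,v\}$ (the graph with that edge removed) containing $u$ and $v$ respectively, $$H(u,v)=2|S_u|-1,\qquad RWC_v(G)^{-1}-RWC_u(G)^{-1}=(|S_u|-|S_v|)(2n-1).$$ -/

import Mathlib

open MeasureTheory ProbabilityTheory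
open scoped ENNReal

universe u

namespace CondorcetTrees

/-! ### Elections on graphs -/

/-- The number of nodes that prefer `u` to `v`, i.e. that are strictly closer to `u` than to `v`.
Distances are `+∞` between different connected components. -/
noncomputable def Net {V : Type u} (G : SimpleGraph V) (u v : V) : ℕ :=
  {w : V | G.edist w u < G.edist w v}.ncard

/-- `u ≻ v`: more nodes prefer `u` to `v` than `v` to `u`. -/
def Beats {V : Type u} (G : SimpleGraph V) (u v : V) : Prop :=
  Net G v u < Net G u v

/-- `u ∼ v`: equally many nodes prefer `u` to `v` and `v` to `u`. -/
def Ties {V : Type u} (G : SimpleGraph V) (u v : V) : Prop :=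
  Net G u v = Net G v u

/-- `u ≽ v`: `u ≻ v` or `u ∼ v`. -/
def WeaklyBeats {V : Type u} (G : SimpleGraph V) (u v : V) : Prop :=
  Beats G u v ∨ Ties G u v

/-- A Condorcet winner: a node that wins against every other node. -/
def IsCondorcetWinner {V : Type u} (G : SimpleGraph V) (u : V) : Prop :=
  ∀ v : V, v ≠ u → Beats G u v

/-! ### Centrality measures -/

/-- A centrality measure assigns a real number to every node of every finite graph. -/
abbrev CentralityMeasure : Type (u + 1) :=
  (V : Type u) → [Fintype V] → SimpleGraph V → V → ℝ

/-- The set of nodes of highest centrality. -/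
def Top (F : CentralityMeasure.{u}) {V : Type u} [Fintype V] (G : SimpleGraph V) : Set V :=
  {v : V | ∀ w : V, F V G w ≤ F V G v}

/-- In every tree with a Condorcet winner `u`, the node `u` is the unique node of highest
centrality. -/
def CondorcetConsistentOnTrees (F : CentralityMeasure.{u}) : Prop :=
  ∀ (V : Type u) [Fintype V] (G : SimpleGraph V), G.IsTree →
    ∀ u : V, IsCondorcetWinner G u → Top F G = {u}

/-- Condorcet Comparison in Trees. -/
def SatisfiesCCT (F : CentralityMeasure.{u}) : Prop :=
  ∀ (V : Type u) [Fintype V] (G : SimpleGraph V), G.IsTree →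
    ∀ u v : V, G.Adj u v → (WeaklyBeats G u v ↔ F V G v ≤ F V G u)

/-! ### Random walks and hitting times -/

open Classical in
/-- One step of the random walk from `u`: a uniformly random neighbour of `u`. (A walk at an
isolated node, where no step is possible, stays there.) -/
noncomputable def step {V : Type u} [Fintype V] (G : SimpleGraph V) (u : V) : PMF V :=
  if h : (G.neighborFinset u).Nonempty then PMF.uniformOfFinset (G.neighborFinset u) h
  else PMF.pure u

/-- The transition kernel of the random walk from the history `x₀, …, xₙ` to the next node; it
depends on the current node `xₙ` only. -/
noncomputable def stepKernel {V : Type u} [Fintype V] [MeasurableSpace V]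
    [DiscreteMeasurableSpace V] (G : SimpleGraph V) (n : ℕ) :
    Kernel ((_ : Finset.Iic n) → V) V where
  toFun x := (step G (x ⟨n, Finset.mem_Iic.2 le_rfl⟩)).toMeasure
  measurable' :=
    (Measurable.of_discrete (f := fun w : V => (step G w).toMeasure)).comp (measurable_pi_apply _)

instance stepKernel_isMarkovKernel {V : Type u} [Fintype V] [MeasurableSpace V] [DiscreteMeasurableSpace V]
    (G : SimpleGraph V) (n : ℕ) : IsMarkovKernel (stepKernel G n) :=
  ⟨fun x => inferInstanceAs
    (IsProbabilityMeasure (step G (x ⟨n, Finset.mem_Iic.2 le_rfl⟩)).toMeasure)⟩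

/-- The law, on the space of all sequences of nodes, of the random walk on `G` started at `u`. -/
noncomputable def walkLaw {V : Type u} [Fintype V] [MeasurableSpace V]
    [DiscreteMeasurableSpace V] (G : SimpleGraph V) (u : V) : Measure (ℕ → V) :=
  Kernel.traj (X := fun _ => V) (stepKernel G) 0 (fun _ => u)

/-- The first time at which the sequence `ω` visits `v` (`∞` if it never does). -/
noncomputable def firstVisit {V : Type u} (v : V) (ω : ℕ → V) : ℝ≥0∞ :=
  ⨅ (t : ℕ) (_ : ω t = v), (t : ℝ≥0∞)

/-- The hitting time `H(u,v)`: the expected number of steps before the random walk started at `u`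
visits `v`. The finite set of nodes carries the discrete σ-algebra. -/
noncomputable def hittingTime {V : Type u} [Fintype V] (G : SimpleGraph V) (u v : V) : ℝ≥0∞ :=
  letI : MeasurableSpace V := ⊤
  haveI : DiscreteMeasurableSpace V := ⟨fun _ => trivial⟩
  ∫⁻ ω, firstVisit v ω ∂(walkLaw G u)

open Classical in
/-- Random-Walk Closeness: the inverse of the sum of the hitting times to `v`. -/
noncomputable def RWCloseness : CentralityMeasure.{u} := fun _ _ G v =>
  ((∑ u ∈ Finset.univ.erase v, hittingTime G u v)⁻¹).toReal

/-- The set `S_u` of nodes in the connected component of `u` in the graph `G - {u,v}`. -/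
def side {V : Type u} (G : SimpleGraph V) (u v : V) : Set V :=
  ((G.deleteEdges {s(u, v)}).connectedComponentMk u).supp

end CondorcetTrees

/-! Everything is governed by the farness Γ(v) = ∑ d(v,w). In a tree with n nodes, the distance to w
has Laplacian deg y - 2 at y, plus 2 if y = w, because exactly one neighbour of y ≠ w is closer to
w. Summing over w, Γ has Laplacian n(deg y - 2) + 2. In h(u) = (n-1)d(u,v) + Γ(v) - Γ(u) the degree
terms combine to -deg u for u ≠ v. So h vanishes at v and solves the Poisson equation of the hitting
time; a finite solution is the hitting time (`lintegral_firstVisit_eq`), hence H(u,v) = h(u).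

Summing over u gives RWC_v⁻¹ = (2n-1)Γ(v) - ∑ Γ, so closeness ranks nodes by decreasing farness.
Across an edge, Γ(v) - Γ(u) = |S_u| - |S_v| and Net(u,v) = |S_u|, which yields CCT and both
formulas. For Condorcet consistency, Γ is convex along paths, so a node strictly better than its
neighbours is the unique minimizer of Γ. -/

namespace CondorcetTrees

/-! ### Distances in trees, their Laplacian, and the candidate hitting time -/

section TreeDistances

variable {V : Type u} {G : SimpleGraph V}

/-- In a tree, a node other than `w` has at most one neighbour closer to `w`. -/
lemma eq_of_adj_of_dist_add_one_eq (hG : G.IsTree) {w y a b : V} (ha : G.Adj y a)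
    (hb : G.Adj y b) (hda : G.dist a w + 1 = G.dist y w) (hdb : G.dist b w + 1 = G.dist y w) :
    a = b := by
  obtain ⟨p, -, hpl⟩ := hG.connected.exists_path_of_dist a w
  obtain ⟨q, -, hql⟩ := hG.connected.exists_path_of_dist b w
  have h1 : (SimpleGraph.Walk.cons ha p).IsPath :=
    SimpleGraph.Walk.isPath_of_length_eq_dist _ (by simp [hpl, hda])
  have h2 : (SimpleGraph.Walk.cons hb q).IsPath :=
    SimpleGraph.Walk.isPath_of_length_eq_dist _ (by simp [hql, hdb])
  have h := (hG.isAcyclic.subsingleton_path y w).elim ⟨_, h1⟩ ⟨_, h2⟩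
  have h' := congrArg (fun r : G.Path y w => r.1.snd) h
  simpa using h'

lemma exists_adj_dist_add_one_eq (hG : G.Connected) {w y : V} (h : y ≠ w) :
    ∃ a, G.Adj y a ∧ G.dist a w + 1 = G.dist y w := by
  obtain ⟨p, hpl⟩ := hG.exists_walk_length_eq_dist y w
  cases p with
  | nil => exact absurd rfl h
  | @cons _ a _ ha p =>
    refine ⟨a, ha, ?_⟩
    have h1 := SimpleGraph.dist_le p
    have h2 := hG.dist_triangle (u := y) (v := a) (w := w)
    rw [SimpleGraph.dist_eq_one_iff_adj.2 ha] at h2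
    rw [SimpleGraph.Walk.length_cons] at hpl
    omega

lemma dist_eq_dist_add_one_or (hG : G.IsTree) (w : V) {x y : V} (h : G.Adj x y) :
    G.dist x w = G.dist y w + 1 ∨ G.dist y w = G.dist x w + 1 := by
  simpa only [SimpleGraph.dist_comm (v := w)] using hG.dist_eq_dist_add_one_of_adj w h

/-- The distance to a fixed node of a tree is convex along paths. -/
lemma two_mul_dist_le_dist_add_dist (hG : G.IsTree) {y a b : V} (ha : G.Adj y a)
    (hb : G.Adj y b) (hab : a ≠ b) (w : V) : 2 * G.dist y w ≤ G.dist a w + G.dist b w := by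
  have h1 := dist_eq_dist_add_one_or hG w ha
  have h2 := dist_eq_dist_add_one_or hG w hb
  by_contra! h
  exact hab (eq_of_adj_of_dist_add_one_eq hG (w := w) ha hb (by omega) (by omega))

open Classical in
/-- The graph Laplacian of the distance to a fixed node of a tree. -/
lemma sum_neighborFinset_dist_sub [Fintype V] (hG : G.IsTree) (w y : V) :
    ∑ x ∈ G.neighborFinset y, ((G.dist x w : ℝ) - G.dist y w)
      = G.degree y - 2 + if y = w then 2 else 0 := by
  split_ifs with h
  · subst h
    rw [Finset.sum_congr rfl (g := fun _ => (1 : ℝ))]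
    · simp
    · intro x hx
      rw [SimpleGraph.mem_neighborFinset] at hx
      simp [SimpleGraph.dist_eq_one_iff_adj.2 hx.symm]
  · obtain ⟨a, ha, hda⟩ := exists_adj_dist_add_one_eq hG.connected h
    have ha' : a ∈ G.neighborFinset y := (G.mem_neighborFinset y a).2 ha
    rw [← Finset.add_sum_erase _ _ ha', Finset.sum_congr rfl (g := fun _ => (1 : ℝ))]
    · have hc := Finset.card_erase_add_one ha'
      rw [SimpleGraph.card_neighborFinset_eq_degree] at hc
      rw [Finset.sum_const, nsmul_eq_mul, ← hda, ← hc]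
      push_cast
      ring
    · intro x hx
      rw [Finset.mem_erase, SimpleGraph.mem_neighborFinset] at hx
      rcases dist_eq_dist_add_one_or hG w hx.2 with h1 | h1
      · exact absurd (eq_of_adj_of_dist_add_one_eq hG hx.2 ha h1.symm hda) hx.1
      · rw [h1]; push_cast; ring

variable [Fintype V]

/-- The sum of the distances from all nodes to `v`. -/
noncomputable def farness (G : SimpleGraph V) (v : V) : ℝ := ∑ w, (G.dist v w : ℝ)

open Classical in
lemma sum_neighborFinset_farness_sub (hG : G.IsTree) (y : V) :
    ∑ x ∈ G.neighborFinset y, (farness G x - farness G y)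
      = Fintype.card V * (G.degree y - 2) + 2 := by
  simp_rw [farness, ← Finset.sum_sub_distrib]
  rw [Finset.sum_comm]
  simp_rw [sum_neighborFinset_dist_sub hG]
  simp [Finset.sum_add_distrib]
  ring

/-- The hitting time from `u` to `v` in a tree, in terms of distances. -/
noncomputable def treeHitting (G : SimpleGraph V) (v u : V) : ℝ :=
  (Fintype.card V - 1) * G.dist u v + farness G v - farness G u

lemma treeHitting_self (v : V) : treeHitting G v v = 0 := by
  simp [treeHitting]

-- The Poisson equation with the degree cleared. The factor n - 1 in `treeHitting` is chosen so that
-- (n-1)(deg - 2) - n(deg - 2) - 2 = -deg.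
open Classical in
lemma sum_neighborFinset_treeHitting (hG : G.IsTree) {u v : V} (h : u ≠ v) :
    ∑ x ∈ G.neighborFinset u, treeHitting G v x = G.degree u * (treeHitting G v u - 1) := by
  have h1 : ∑ x ∈ G.neighborFinset u, (treeHitting G v x - treeHitting G v u)
      = -(G.degree u : ℝ) := by
    have h2 : ∀ x, treeHitting G v x - treeHitting G v u
        = (Fintype.card V - 1) * ((G.dist x v : ℝ) - G.dist u v)
          - (farness G x - farness G u) := by
      intro x; unfold treeHitting; ring
    simp_rw [h2]
    rw [Finset.sum_sub_distrib, ← Finset.mul_sum, sum_neighborFinset_dist_sub hG,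
      sum_neighborFinset_farness_sub hG, if_neg h]
    ring
  rw [Finset.sum_sub_distrib, Finset.sum_const, nsmul_eq_mul,
    SimpleGraph.card_neighborFinset_eq_degree] at h1
  linarith

/-- `treeHitting` is a sum of triangle defects minus one d(u,v), and the defect at w = u is already
2d(u,v). This supplies the nonnegativity needed to pass to `ℝ≥0∞`, and positivity off the diagonal.
-/
lemma dist_le_treeHitting (hG : G.Connected) (u v : V) :
    (G.dist u v : ℝ) ≤ treeHitting G v u := by
  have h1 : treeHitting G v u
      = ∑ w, ((G.dist u v : ℝ) + G.dist v w - G.dist u w) - G.dist u v := by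
    rw [Finset.sum_sub_distrib, Finset.sum_add_distrib, treeHitting, farness, farness]
    simp
    ring
  have h2 : ∀ w, 0 ≤ (G.dist u v : ℝ) + G.dist v w - G.dist u w := fun w => by
    have := hG.dist_triangle (u := u) (v := v) (w := w)
    rify at this
    linarith
  have h3 := Finset.single_le_sum (fun w _ => h2 w) (Finset.mem_univ u)
  rw [SimpleGraph.dist_self, SimpleGraph.dist_comm (u := v)] at h3
  push_cast at h3
  linarith

lemma sum_treeHitting (v : V) :
    ∑ u, treeHitting G v u
      = (2 * (Fintype.card V : ℝ) - 1) * farness G v - ∑ u, farness G u := by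
  simp only [treeHitting, Finset.sum_sub_distrib, Finset.sum_add_distrib, ← Finset.mul_sum]
  have h : ∑ u, (G.dist u v : ℝ) = farness G v := by
    simp_rw [farness, SimpleGraph.dist_comm (u := v)]
  rw [h]
  simp
  ring

end TreeDistances

/-! ### The two sides of an edge, and farness as the Condorcet order -/

section Sides

variable {V : Type u} {G : SimpleGraph V}

lemma edist_lt_edist_iff (hG : G.Connected) (w u v : V) :
    G.edist w u < G.edist w v ↔ G.dist w u < G.dist w v := by
  rw [← (hG w u).coe_dist_eq_edist, ← (hG w v).coe_dist_eq_edist, Nat.cast_lt]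

/-- A shortest walk from w to u cannot meet v, which is farther from w, so it does not use the
deleted edge. -/
lemma reachable_deleteEdges_of_dist_lt (hG : G.Connected) {u v w : V}
    (h : G.dist w u < G.dist w v) : (G.deleteEdges {s(u, v)}).Reachable w u := by
  classical
  obtain ⟨p, hpl⟩ := hG.exists_walk_length_eq_dist w u
  have hv : v ∉ p.support := fun hv => by
    have h1 := SimpleGraph.dist_le (p.takeUntil v hv)
    have h2 := p.length_takeUntil_le_length hv
    omega
  exact ⟨p.toDeleteEdge s(u, v) fun he => hv (p.snd_mem_support_of_mem_edges he)⟩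

lemma side_eq (hG : G.IsTree) {u v : V} (huv : G.Adj u v) :
    side G u v = {w | G.dist w u < G.dist w v} := by
  have hb := SimpleGraph.isBridge_iff.1
    (SimpleGraph.isAcyclic_iff_forall_adj_isBridge.1 hG.isAcyclic huv)
  ext w
  rw [side, SimpleGraph.ConnectedComponent.mem_supp_iff, SimpleGraph.ConnectedComponent.eq,
    Set.mem_ofPred_eq]
  refine ⟨fun h => ?_, reachable_deleteEdges_of_dist_lt hG.connected⟩
  by_contra hlt
  have hne := hG.dist_ne_of_adj w huv
  have h1 := reachable_deleteEdges_of_dist_lt hG.connected (u := v) (v := u) (w := w) (by omega)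
  rw [Sym2.eq_swap] at h1
  exact hb (h.symm.trans h1)

lemma ncard_side (hG : G.IsTree) {u v : V} (huv : G.Adj u v) :
    (side G u v).ncard = Net G u v := by
  rw [side_eq hG huv, Net]
  simp_rw [edist_lt_edist_iff hG.connected]

variable [Fintype V]

open Classical in
lemma ncard_side_eq_sum (hG : G.IsTree) {u v : V} (huv : G.Adj u v) :
    ((side G u v).ncard : ℝ) = ∑ w, if G.dist w u < G.dist w v then (1 : ℝ) else 0 := by
  rw [side_eq hG huv, Set.ncard_eq_toFinset_card']
  simp

lemma ncard_side_add_ncard_side (hG : G.IsTree) {u v : V} (huv : G.Adj u v) :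
    ((side G u v).ncard : ℝ) + (side G v u).ncard = Fintype.card V := by
  classical
  rw [ncard_side_eq_sum hG huv, ncard_side_eq_sum hG huv.symm, ← Finset.sum_add_distrib,
    Finset.sum_congr rfl (g := fun _ => (1 : ℝ))]
  · simp
  · intro w _
    have := hG.dist_ne_of_adj w huv
    split_ifs <;> first | omega | norm_num

/-- Each node contributes +1 or -1 according to its side, since its distances to u and v differ by
exactly one. -/
lemma farness_sub_farness (hG : G.IsTree) {u v : V} (huv : G.Adj u v) :
    farness G v - farness G u = ((side G u v).ncard : ℝ) - (side G v u).ncard := by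
  classical
  rw [ncard_side_eq_sum hG huv, ncard_side_eq_sum hG huv.symm, farness, farness,
    ← Finset.sum_sub_distrib, ← Finset.sum_sub_distrib]
  refine Finset.sum_congr rfl fun w _ => ?_
  rw [SimpleGraph.dist_comm (u := v), SimpleGraph.dist_comm (u := u)]
  rcases hG.dist_eq_dist_add_one_of_adj w huv with h | h
  · rw [if_neg (by omega), if_pos (by omega), h]; push_cast; ring
  · rw [if_pos (by omega), if_neg (by omega), h]; push_cast; ring

lemma treeHitting_of_adj (hG : G.IsTree) {u v : V} (huv : G.Adj u v) :
    treeHitting G v u = 2 * ((side G u v).ncard : ℝ) - 1 := by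
  have h1 := farness_sub_farness hG huv
  have h2 := ncard_side_add_ncard_side hG huv
  rw [treeHitting, SimpleGraph.dist_eq_one_iff_adj.2 huv]
  push_cast
  linarith

lemma beats_iff_farness_lt (hG : G.IsTree) {u v : V} (huv : G.Adj u v) :
    Beats G u v ↔ farness G u < farness G v := by
  have h := farness_sub_farness hG huv
  rw [Beats, ← ncard_side hG huv, ← ncard_side hG huv.symm, ← Nat.cast_lt (α := ℝ)]
  constructor <;> intro <;> linarith

lemma weaklyBeats_iff_farness_le (hG : G.IsTree) {u v : V} (huv : G.Adj u v) :
    WeaklyBeats G u v ↔ farness G u ≤ farness G v := by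
  rw [← not_lt, ← beats_iff_farness_lt hG huv.symm, WeaklyBeats, Beats, Beats, Ties]
  omega

lemma two_mul_farness_le (hG : G.IsTree) {y a b : V} (ha : G.Adj y a) (hb : G.Adj y b)
    (hab : a ≠ b) : 2 * farness G y ≤ farness G a + farness G b := by
  rw [farness, farness, farness, Finset.mul_sum, ← Finset.sum_add_distrib]
  exact Finset.sum_le_sum fun w _ => by
    exact_mod_cast two_mul_dist_le_dist_add_dist hG ha hb hab w

/-- A node of a tree that is strictly better than its neighbours is strictly better than all
other nodes; moreover the farness increases along paths leaving it. -/
lemma farness_lt_of_forall_adj (hG : G.IsTree) {u : V}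
    (hu : ∀ x, G.Adj u x → farness G u < farness G x) (k : ℕ) :
    ∀ v p, G.dist v u = k + 1 → G.Adj v p → G.dist p u = k →
      farness G p < farness G v ∧ farness G u < farness G v := by
  induction k with
  | zero =>
    intro v p _ hvp hp
    obtain rfl := hG.connected.dist_eq_zero_iff.1 hp
    exact ⟨hu v hvp.symm, hu v hvp.symm⟩
  | succ k ih =>
    intro v p hv hvp hp
    have hpu : p ≠ u := by rintro rfl; simp at hp
    obtain ⟨q, hpq, hq⟩ := exists_adj_dist_add_one_eq hG.connected hpu
    obtain ⟨h1, h2⟩ := ih p q hp hpq (by omega)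
    have hqv : q ≠ v := by rintro rfl; omega
    -- Convexity at p: the increase from q to p forces one at least as large from p to v.
    have h3 := two_mul_farness_le hG hpq hvp.symm hqv
    constructor <;> linarith

lemma IsCondorcetWinner.farness_lt (hG : G.IsTree) {u : V} (hu : IsCondorcetWinner G u) {v : V}
    (hv : v ≠ u) : farness G u < farness G v := by
  obtain ⟨p, hp, hd⟩ := exists_adj_dist_add_one_eq hG.connected hv
  exact (farness_lt_of_forall_adj hG (fun x hx => (beats_iff_farness_lt hG hx).1 (hu x hx.ne'))
    _ v p hd.symm hp rfl).2

end Sides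

/-! ### Hitting times as solutions of the Poisson equation -/

section HittingTimes

variable {V : Type u}

/-- The sequences that do not visit `v` up to time `n`. -/
def avoids (v : V) (n : ℕ) : Set (ℕ → V) := {ω | ∀ i ≤ n, ω i ≠ v}

/-- The tail-sum formula T = ∑ 1[T > n]; both sides are infinite if v is never visited. -/
lemma firstVisit_eq_tsum (v : V) (ω : ℕ → V) :
    firstVisit v ω = ∑' n, (avoids v n).indicator 1 ω := by
  classical
  by_cases h : ∃ t, ω t = v
  · have h1 : ∀ n, (avoids v n).indicator (1 : (ℕ → V) → ℝ≥0∞) ω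
        = if n ∈ Finset.range (Nat.find h) then 1 else 0 := by
      intro n
      rw [Set.indicator_apply]
      refine if_congr ?_ rfl rfl
      rw [Finset.mem_range, Nat.lt_find_iff]
      rfl
    simp_rw [h1]
    rw [tsum_eq_sum (s := Finset.range (Nat.find h)) (fun n hn => if_neg hn),
      Finset.sum_congr rfl (fun n hn => if_pos hn)]
    simp only [Finset.sum_const, Finset.card_range, nsmul_eq_mul, mul_one]
    refine le_antisymm (iInf₂_le (Nat.find h) (Nat.find_spec h)) (le_iInf₂ fun t ht => ?_)
    exact_mod_cast Nat.find_min' h ht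
  · push Not at h
    have h1 : ∀ n, ω ∈ avoids v n := fun n i _ => h i
    simp [firstVisit, h, h1]

variable [MeasurableSpace V] [DiscreteMeasurableSpace V]

lemma measurableSet_avoids (v : V) (n : ℕ) : MeasurableSet (avoids v n) := by
  have : avoids v n = ⋂ i ∈ Set.Iic n, (fun ω : ℕ → V => ω i) ⁻¹' {v}ᶜ := by
    ext; simp [avoids]
  rw [this]
  exact MeasurableSet.biInter (Set.to_countable _) fun i _ =>
    measurable_pi_apply i (MeasurableSet.of_discrete)

variable [Fintype V]

/-- The Markov property at time `n`. -/
lemma lintegral_walkLaw_succ (G : SimpleGraph V) (u : V) (n : ℕ)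
    {g : ((_ : Finset.Iic n) → V) → ℝ≥0∞} (hg : Measurable g) (f : V → ℝ≥0∞) :
    ∫⁻ ω, g (Preorder.frestrictLe n ω) * f (ω (n + 1)) ∂(walkLaw G u)
      = ∫⁻ ω, g (Preorder.frestrictLe n ω) * ∫⁻ w, f w ∂(step G (ω n)).toMeasure
          ∂(walkLaw G u) := by
  have hf : Measurable f := Measurable.of_discrete
  have h1 := Kernel.partialTraj_compProd_eq_map_traj (X := fun _ => V) (κ := stepKernel G)
    (a := 0) (b := n) (Nat.zero_le n) (x₀ := fun _ => u)
  have h2 : Measurable fun p : ((_ : Finset.Iic n) → V) × V => g p.1 * f p.2 :=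
    (hg.comp measurable_fst).mul (hf.comp measurable_snd)
  have h3 : Measurable fun x : (_ : Finset.Iic n) → V =>
      ∫⁻ w, f w ∂(stepKernel G n x) := hf.lintegral_kernel
  have h4 := MeasureTheory.lintegral_map (μ := walkLaw G u) h2
    (g := fun x : ℕ → V => (Preorder.frestrictLe (π := fun _ => V) n x, x (n + 1)))
    (by fun_prop)
  have h5 := MeasureTheory.lintegral_map (μ := walkLaw G u) (hg.mul h3)
    (g := Preorder.frestrictLe (π := fun _ => V) n) (by fun_prop)
  refine h4.symm.trans (Eq.trans ?_ h5)
  unfold walkLaw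
  rw [← h1, Kernel.traj_map_frestrictLe_apply, Measure.lintegral_compProd h2]
  refine lintegral_congr fun x => ?_
  exact lintegral_const_mul (μ := stepKernel G n x) (g x) hf

lemma lintegral_walkLaw_zero (G : SimpleGraph V) (u : V) (f : V → ℝ≥0∞) :
    ∫⁻ ω, f (ω 0) ∂(walkLaw G u) = f u := by
  have hf : Measurable fun x : (_ : Finset.Iic 0) → V => f (x ⟨0, Finset.mem_Iic.2 le_rfl⟩) :=
    (Measurable.of_discrete (f := f)).comp (measurable_pi_apply _)
  have h := MeasureTheory.lintegral_map (μ := walkLaw G u) hf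
    (g := Preorder.frestrictLe (π := fun _ => V) 0) (by fun_prop)
  refine h.symm.trans ?_
  unfold walkLaw
  rw [Kernel.traj_map_frestrictLe_apply, Kernel.partialTraj_self, Kernel.id_apply,
    lintegral_dirac' _ hf]

/-- The expected value of `f` at time `n` on the walks that avoid `v` until then. -/
noncomputable def avoidingMean (G : SimpleGraph V) (u v : V) (f : V → ℝ≥0∞) (n : ℕ) : ℝ≥0∞ :=
  ∫⁻ ω, (avoids v n).indicator (fun ω => f (ω n)) ω ∂(walkLaw G u)

/-- One step of the telescoping: where v has been avoided, the Poisson equation trades f at time n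
for 1 plus the mean of f at time n + 1. -/
lemma avoidingMean_eq_add (G : SimpleGraph V) (u v : V) {f : V → ℝ≥0∞} (hv : f v = 0)
    (hf : ∀ x, x ≠ v → f x = 1 + ∫⁻ w, f w ∂(step G x).toMeasure) (n : ℕ) :
    avoidingMean G u v f n = walkLaw G u (avoids v n) + avoidingMean G u v f (n + 1) := by
  set g : ((_ : Finset.Iic n) → V) → ℝ≥0∞ := Set.indicator {x | ∀ i, x i ≠ v} 1 with hg
  have hgm : Measurable g := by
    refine measurable_one.indicator ?_
    have : {x : (_ : Finset.Iic n) → V | ∀ i, x i ≠ v} = ⋂ i, (fun x => x i) ⁻¹' {v}ᶜ := by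
      ext; simp
    rw [this]
    exact MeasurableSet.iInter fun i => measurable_pi_apply i MeasurableSet.of_discrete
  have hmem : ∀ ω : ℕ → V, Preorder.frestrictLe (π := fun _ => V) n ω ∈
      {x : (_ : Finset.Iic n) → V | ∀ i, x i ≠ v} ↔ ω ∈ avoids v n := fun ω =>
    ⟨fun h i hi => h ⟨i, Finset.mem_Iic.2 hi⟩, fun h i => h i (Finset.mem_Iic.1 i.2)⟩
  have hgi : ∀ ω : ℕ → V, g (Preorder.frestrictLe (π := fun _ => V) n ω)
      = (avoids v n).indicator 1 ω := fun ω => by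
    classical
    rw [hg, Set.indicator_apply, Set.indicator_apply]
    exact if_congr (hmem ω) rfl rfl
  -- As f vanishes at v, avoidance up to n + 1 may be weakened to avoidance up to n, an event of the
  -- history to which the Markov property applies.
  have h1 : avoidingMean G u v f (n + 1)
      = ∫⁻ ω, g (Preorder.frestrictLe n ω) * f (ω (n + 1)) ∂(walkLaw G u) := by
    refine lintegral_congr fun ω => ?_
    rw [hgi]
    by_cases h : ω (n + 1) = v
    · simp [h, hv]
    · have : ω ∈ avoids v (n + 1) ↔ ω ∈ avoids v n :=
        ⟨fun h' i hi => h' i (hi.trans n.le_succ), fun h' i hi => by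
          rcases Nat.le_succ_iff.1 hi with hi | rfl
          exacts [h' i hi, h]⟩
      by_cases h' : ω ∈ avoids v n <;> simp [this, h']
  rw [h1, lintegral_walkLaw_succ G u n hgm, ← lintegral_indicator_one (measurableSet_avoids v n),
    ← lintegral_add_left (measurable_one.indicator (measurableSet_avoids v n))]
  refine lintegral_congr fun ω => ?_
  rw [hgi]
  by_cases h' : ω ∈ avoids v n
  · simp [h', hf _ (h' n le_rfl)]
  · simp [h']

/-- A finite solution of the Poisson equation is the expected time of the first visit. -/
lemma lintegral_firstVisit_eq (G : SimpleGraph V) (u v : V) {f : V → ℝ≥0∞} (hv : f v = 0)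
    (hf : ∀ x, x ≠ v → f x = 1 + ∫⁻ w, f w ∂(step G x).toMeasure) (hfin : ∀ x, f x ≠ ⊤) :
    ∫⁻ ω, firstVisit v ω ∂(walkLaw G u) = f u := by
  have h0 : avoidingMean G u v f 0 = f u := by
    rw [← lintegral_walkLaw_zero G u f]
    refine lintegral_congr fun ω => ?_
    by_cases h : ω 0 = v
    · simp [h, hv]
    · rw [Set.indicator_of_mem]
      rintro i hi
      rwa [Nat.le_zero.1 hi]
  have hsum : ∀ n, ∑ i ∈ Finset.range n, walkLaw G u (avoids v i) + avoidingMean G u v f n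
      = f u := by
    intro n
    induction n with
    | zero => simpa using h0
    | succ n ih =>
      rw [Finset.sum_range_succ, add_assoc, ← avoidingMean_eq_add G u v hv hf, ih]
  have htop : ∑' n, walkLaw G u (avoids v n) ≠ ⊤ := by
    refine ne_top_of_le_ne_top (hfin u) (ENNReal.tsum_le_of_sum_range_le fun n => ?_)
    rw [← hsum n]
    exact le_self_add
  -- The remainder is at most ∑ f times the probability of avoiding v, the general term of a series
  -- just bounded by f u < ∞.
  have hlim0 : Filter.Tendsto (fun n => (∑ x, f x) * walkLaw G u (avoids v n)) Filter.atTop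
      (nhds 0) := by
    have := ENNReal.Tendsto.const_mul (a := ∑ x, f x)
      (ENNReal.tendsto_atTop_zero_of_tsum_ne_top htop)
      (Or.inr (ENNReal.sum_ne_top.2 fun x _ => hfin x))
    simpa using this
  have hlim1 : Filter.Tendsto (avoidingMean G u v f) Filter.atTop (nhds 0) := by
    refine tendsto_of_tendsto_of_tendsto_of_le_of_le tendsto_const_nhds hlim0
      (fun _ => zero_le) fun n => ?_
    have : ∫⁻ ω, (∑ x, f x) * (avoids v n).indicator 1 ω ∂(walkLaw G u)
        = (∑ x, f x) * walkLaw G u (avoids v n) := by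
      rw [lintegral_const_mul _ (measurable_one.indicator (measurableSet_avoids v n)),
        lintegral_indicator_one (measurableSet_avoids v n)]
    change _ ≤ (∑ x, f x) * walkLaw G u (avoids v n)
    rw [← this]
    refine lintegral_mono fun ω => ?_
    by_cases h' : ω ∈ avoids v n
    · simpa [h'] using Finset.single_le_sum (f := f) (fun _ _ => zero_le) (Finset.mem_univ (ω n))
    · simp [h']
  have hlim2 := (ENNReal.tendsto_nat_tsum fun n => walkLaw G u (avoids v n)).add hlim1
  simp_rw [hsum, add_zero] at hlim2
  rw [tendsto_nhds_unique tendsto_const_nhds hlim2]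
  simp_rw [firstVisit_eq_tsum]
  rw [lintegral_tsum fun n =>
    (measurable_one.indicator (measurableSet_avoids v n)).aemeasurable]
  simp_rw [lintegral_indicator_one (measurableSet_avoids v _)]

end HittingTimes

open Classical in
lemma lintegral_step {V : Type u} [Fintype V] [MeasurableSpace V] [DiscreteMeasurableSpace V]
    (G : SimpleGraph V) {x : V} (hx : (G.neighborFinset x).Nonempty) (f : V → ℝ≥0∞) :
    ∫⁻ w, f w ∂(step G x).toMeasure
      = (∑ w ∈ G.neighborFinset x, f w) * (G.degree x : ℝ≥0∞)⁻¹ := by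
  rw [lintegral_fintype, step, dif_pos hx]
  simp_rw [PMF.toMeasure_apply_singleton _ _ (MeasurableSet.singleton _),
    PMF.uniformOfFinset_apply, mul_ite, mul_zero, SimpleGraph.card_neighborFinset_eq_degree]
  rw [Finset.sum_ite_mem, Finset.univ_inter, Finset.sum_mul]

/-! ### Hitting times and closeness in trees -/

section Trees

variable {V : Type u} [Fintype V] {G : SimpleGraph V}

lemma treeHitting_nonneg (hG : G.IsTree) (u v : V) : 0 ≤ treeHitting G v u :=
  (Nat.cast_nonneg _).trans (dist_le_treeHitting hG.connected u v)

lemma treeHitting_pos (hG : G.IsTree) {u v : V} (h : u ≠ v) : 0 < treeHitting G v u :=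
  (Nat.cast_pos.2 (hG.connected.pos_dist_of_ne h)).trans_le
    (dist_le_treeHitting hG.connected u v)

lemma hittingTime_eq_ofReal (hG : G.IsTree) (u v : V) :
    hittingTime G u v = ENNReal.ofReal (treeHitting G v u) := by
  classical
  -- The same σ-algebra as inside `hittingTime`, so that the goal unfolds to the integral of
  -- `firstVisit`.
  let : MeasurableSpace V := ⊤
  have : DiscreteMeasurableSpace V := ⟨fun _ => trivial⟩
  refine lintegral_firstVisit_eq G u v (f := fun x => ENNReal.ofReal (treeHitting G v x))
    (by simp [treeHitting_self]) (fun x hx => ?_) (fun x => ENNReal.ofReal_ne_top)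
  obtain ⟨a, ha, -⟩ := exists_adj_dist_add_one_eq hG.connected hx
  have hne : (G.neighborFinset x).Nonempty := ⟨a, (G.mem_neighborFinset x a).2 ha⟩
  have hd : (0 : ℝ) < G.degree x := by
    rw [← SimpleGraph.card_neighborFinset_eq_degree]
    exact_mod_cast hne.card_pos
  have hsum := sum_neighborFinset_treeHitting hG hx
  have h0 : 0 ≤ ∑ w ∈ G.neighborFinset x, treeHitting G v w :=
    Finset.sum_nonneg fun w _ => treeHitting_nonneg hG w v
  rw [lintegral_step G hne, ← ENNReal.ofReal_sum_of_nonneg fun w _ => treeHitting_nonneg hG w v,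
    ← ENNReal.ofReal_natCast, ← ENNReal.ofReal_inv_of_pos hd, ← ENNReal.ofReal_mul h0,
    ← ENNReal.ofReal_one, ← ENNReal.ofReal_add zero_le_one (by positivity), hsum]
  congr 1
  field_simp
  ring

/-- The omitted term u = v is zero, so the sum may run over all nodes. For a single node both sides
are 0: the closeness is `⊤.toReal = 0`, and 0⁻¹ = 0 in ℝ. -/
lemma RWCloseness_inv (hG : G.IsTree) (v : V) :
    (RWCloseness V G v)⁻¹
      = (2 * (Fintype.card V : ℝ) - 1) * farness G v - ∑ u, farness G u := by
  classical
  rw [RWCloseness, ENNReal.toReal_inv, inv_inv, ← sum_treeHitting,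
    ENNReal.toReal_sum fun u _ => by simp [hittingTime_eq_ofReal hG]]
  simp_rw [hittingTime_eq_ofReal hG, ENNReal.toReal_ofReal (treeHitting_nonneg hG _ _)]
  exact Finset.sum_erase _ (treeHitting_self v)

lemma RWCloseness_pos (hG : G.IsTree) {u v : V} (h : u ≠ v) : 0 < RWCloseness V G v := by
  rw [← inv_pos, RWCloseness_inv hG, ← sum_treeHitting]
  exact (treeHitting_pos hG h).trans_le (Finset.single_le_sum
    (f := fun u => treeHitting G v u) (fun w _ => treeHitting_nonneg hG w v) (Finset.mem_univ u))

lemma RWCloseness_le_iff (hG : G.IsTree) (u v : V) :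
    RWCloseness V G v ≤ RWCloseness V G u ↔ farness G u ≤ farness G v := by
  -- Inverting the inequality needs positive closeness, which requires two distinct nodes.
  rcases eq_or_ne u v with rfl | h
  · simp
  have hn : (0 : ℝ) < 2 * (Fintype.card V : ℝ) - 1 := by
    have : (1 : ℝ) ≤ Fintype.card V := by exact_mod_cast Fintype.card_pos_iff.2 ⟨u⟩
    linarith
  rw [← inv_le_inv₀ (RWCloseness_pos hG h.symm) (RWCloseness_pos hG h), RWCloseness_inv hG,
    RWCloseness_inv hG, sub_le_sub_iff_right, mul_le_mul_iff_right₀ hn]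

end Trees

lemma RWCloseness_condorcetConsistentOnTrees :
    CondorcetConsistentOnTrees.{u} RWCloseness.{u} := by
  intro V _ G hG u hu
  ext v
  refine ⟨fun hv => ?_, ?_⟩
  · by_contra hne
    exact (hu.farness_lt hG hne).not_ge ((RWCloseness_le_iff hG v u).1 (hv u))
  · rintro rfl w
    rw [RWCloseness_le_iff hG]
    rcases eq_or_ne w v with rfl | hne
    · exact le_rfl
    · exact (hu.farness_lt hG hne).le

lemma RWCloseness_satisfiesCCT : SatisfiesCCT.{u} RWCloseness.{u} := by
  intro V _ G hG u v huv
  rw [RWCloseness_le_iff hG, weaklyBeats_iff_farness_le hG huv]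

end CondorcetTrees

theorem mainTheorem3 :
    CondorcetTrees.CondorcetConsistentOnTrees.{u} CondorcetTrees.RWCloseness.{u} ∧
    CondorcetTrees.SatisfiesCCT.{u} CondorcetTrees.RWCloseness.{u} ∧
    ∀ (V : Type u) [Fintype V] (G : SimpleGraph V), G.IsTree →
      (∀ u v : V, CondorcetTrees.hittingTime G u v ≠ ⊤) ∧
      ∀ u v : V, G.Adj u v →
        (CondorcetTrees.hittingTime G u v).toReal
            = 2 * ((CondorcetTrees.side G u v).ncard : ℝ) - 1 ∧
        (CondorcetTrees.RWCloseness V G v)⁻¹ - (CondorcetTrees.RWCloseness V G u)⁻¹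
            = (((CondorcetTrees.side G u v).ncard : ℝ) - ((CondorcetTrees.side G v u).ncard : ℝ))
              * (2 * (Fintype.card V : ℝ) - 1) := by
  refine ⟨CondorcetTrees.RWCloseness_condorcetConsistentOnTrees,
    CondorcetTrees.RWCloseness_satisfiesCCT, fun V _ G hG => ⟨fun u v => ?_, fun u v huv => ⟨?_, ?_⟩⟩⟩
  · simp [CondorcetTrees.hittingTime_eq_ofReal hG]
  · rw [CondorcetTrees.hittingTime_eq_ofReal hG,
      ENNReal.toReal_ofReal (CondorcetTrees.treeHitting_nonneg hG u v),
      CondorcetTrees.treeHitting_of_adj hG huv]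
  · rw [CondorcetTrees.RWCloseness_inv hG, CondorcetTrees.RWCloseness_inv hG,
      ← CondorcetTrees.farness_sub_farness hG huv]
    ring
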